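/- Let $I$ be a countably infinite index set, $\mathcal U$ a nonprincipal ultrafilter on $I$, and $K$ a number field. Let ${}^*K=\prod_{\mathcal U}K$ be the ultrapower of $K$ with respect to $\mathcal U$, regarded as an extension field of $K$ through the diagonal embedding. Let $E$ be a (nonsingular) elliptic curve over $K$. For an extension field $L$ of $K$, let $E(L)$ be the group of $L$-rational points of $E$ and let $\operatorname{rk}E(L)$ be the (cardinal) dimension of the $\mathbb Q$-vector space $E(L)\otimes_{\mathbb Z}\mathbb Q$. Then: 1. If $\operatorname{rk}E(K)\neq 0$, then $\operatorname{rk}E({}^*K)=2^{\aleph_0}$; in particular $\operatorname{rk}E({}^*K)$ is infinite and $\operatorname{rk}E({}^*K)>\operatorname{rk}E(K)$. 2. If $\operatorname{rk}E(K)=0$, then $E({}^*K)=E(K)$, i.e. the natural embedding $E(K)\hookrightarrow E({}^*K)$ is bijective. -/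

import Mathlib

open Cardinal TensorProduct
open scoped WeierstrassCurve.Affine

universe u v

noncomputable section

/-- The ultrapower `*K = Π_U K` of `K` with respect to an ultrafilter `U` on `ι`: functions
`ι → K`, two of them being identified when they agree on a set belonging to `U`. Its field
structure is the pointwise one. -/
abbrev Ultrapower {ι : Type*} (U : Ultrafilter ι) (K : Type*) : Type _ :=
  Filter.Germ (U : Filter ι) K

/-- The diagonal embedding `K → *K`, sending `c` to the class of the constant family `(c)`. -/
def Ultrapower.diag {ι : Type*} (U : Ultrafilter ι) (K : Type*) [Field K] :
    K →+* Ultrapower U K :=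
  (Filter.Germ.coeRingHom (U : Filter ι)).comp (Pi.constRingHom ι K)

/-- `*K` is an extension field of `K` through the diagonal embedding. -/
instance Ultrapower.instAlgebra {ι : Type*} (U : Ultrafilter ι) (K : Type*) [Field K] :
    Algebra K (Ultrapower U K) where
  algebraMap := Ultrapower.diag U K
  commutes' _ _ := mul_comm _ _
  smul_def' c x := by
    induction x using Filter.Germ.inductionOn with
    | _ f => rfl

/-- The rank `rk E(L)`: the dimension, as a cardinal, of the `ℚ`-vector space `ℚ ⊗ E(L)`, where
`E(L)` is the group of `L`-rational points of the elliptic curve `E` over `K` and `L` is an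
extension field of `K`. -/
def ellRank {K : Type*} [Field K] (E : WeierstrassCurve K) (L : Type*) [Field L] [Algebra K L]
    [DecidableEq L] : Cardinal :=
  Module.rank ℚ (ℚ ⊗[ℤ] (E.toAffine⁄L).Point)

end

/-!
A point of `E(*K)` is given by a family of points of `E(K)`, up to equality `U`-almost everywhere,
because the Weierstrass equation and the group law are polynomial or rational with a finite
number of cases. `Ultrapower.pointOfFamilyHom` is the resulting homomorphism from families of points
to `E(*K)`; its kernel consists of the families that vanish almost everywhere.

If `rk E(K) ≠ 0`, there is a point `P` of infinite order. For real `r`, the integers `⌊n r⌋` with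
`n = 0, 1, 2, …` (indexed by `ι` through a bijection with `ℕ`) determine `r` as soon as they are
known for infinitely many `n`. So the families `n ↦ ⌊n r⌋ • P` define `𝔠` points of `E(*K)` that
stay distinct modulo torsion (`continuum_le_mk_rat_tensor`). Thus `ℚ ⊗ E(*K)` has cardinality, and
therefore dimension over the countable field `ℚ`, at least `𝔠`. The dimension is at most `𝔠` since
`*K` is a quotient of `ι → K`, where `ι` and `K` are countable. As `E(K)` is countable, `rk E(K)` is
at most `ℵ₀ < 𝔠`.

If `rk E(K) = 0`, every point of `E(K)` is torsion. The duplication formula gives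
`h(2P) ≥ 4 h(P) - C` for the naive height `h`, so torsion points have bounded height, and by
the Northcott property of number fields there are finitely many of them
(`WeierstrassCurve.Affine.Point.finite_torsion`). A family of points of the finite set `E(K)` is
constant almost everywhere, so every point of `E(*K)` comes from `E(K)`
(`Ultrapower.baseChange_bijective_of_finite`).
-/

/-! ### Heights and torsion points -/

namespace WeierstrassCurve.Affine.Point

open Height MvPolynomial

variable {K : Type*} [Field K] {W : WeierstrassCurve K}

/-- The naive height on `E(K)` has the Northcott property if the height on `K` does, since
the `x`-coordinate map has fibres `{P, -P}`. -/
lemma northcott_logHeight_xRep [AdmissibleAbsValues K] [Northcott (logHeight₁ (K := K))] :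
    Northcott fun P : W.toAffine.Point ↦ logHeight P.xRep where
  finite_le B := by
    have hfin : ({![1, 0]} ∪ (fun x : K ↦ ![x, 1]) '' {x | logHeight₁ x ≤ B}).Finite :=
      (Set.finite_singleton _).union ((Northcott.finite_le B).image _)
    refine Set.Finite.of_finite_fibers xRep (hfin.subset ?_) fun r _ ↦ ?_
    · rintro _ ⟨P, hP, rfl⟩
      rcases P with _ | ⟨x, y, h⟩
      · exact .inl rfl
      · refine .inr ⟨x, ?_, rfl⟩
        simpa [logHeight₁_eq_logHeight] using hP
    · by_cases hr : ∃ P : W.toAffine.Point, P.xRep = r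
      · obtain ⟨P, rfl⟩ := hr
        exact (Set.toFinite {P, -P}).subset fun Q hQ ↦ by
          simpa using xRep_eq_xRep_iff.mp hQ.2
      · exact Set.finite_empty.subset fun Q hQ ↦ hr ⟨Q, hQ.2⟩

variable [DecidableEq K]

/-- The duplication formula `x(2P) = (x⁴ - b₄x² - 2b₆x - b₈) / (4x³ + b₂x² + 2b₄x + b₆)`, as an
identity of points of `ℙ²`: on the diagonal, `addSubMap` sends the class of `{x(P), x(P)}` to that
of `{x(2P), ∞}`. -/
lemma exists_smul_sym2x_two_nsmul [W.IsElliptic] (P : W.toAffine.Point) :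
    ∃ c : K, c ≠ 0 ∧ (fun i ↦ (addSubMap W i).eval (P.sym2x P)) = c • (2 • P).sym2x 0 := by
  have hF := addSubMap_ne_zero W (sym2x_ne_zero P P)
  rcases P with _ | ⟨x, y, h⟩
  · refine ⟨1, one_ne_zero, ?_⟩
    ext i
    fin_cases i <;> simp [← zero_def, addSubMap]
  -- `d = 2y + a₁x + a₃` is the denominator of the tangent slope; it vanishes iff `2P = 0`.
  set d := y - W.toAffine.negY x y with hd
  have heq := (W.toAffine.equation_iff x y).mp h.1
  have hd2 : d ^ 2 = 4 * x ^ 3 + W.b₂ * x ^ 2 + 2 * W.b₄ * x + W.b₆ := by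
    simp only [hd, negY, b₂, b₄, b₆]
    linear_combination 4 * heq
  have hF' : (fun i ↦ (addSubMap W i).eval ((some x y h).sym2x (some x y h))) =
      ![x ^ 4 - W.b₄ * x ^ 2 - 2 * W.b₆ * x - W.b₈, d ^ 2, 0] := by
    ext i
    fin_cases i
    · simp [addSubMap]; ring
    · simp [addSubMap, hd2]; ring
    · simp [addSubMap]; ring
  rw [hF'] at hF ⊢
  by_cases hy : y = W.toAffine.negY x y
  · have hd0 : d = 0 := sub_eq_zero.mpr hy
    rw [two_nsmul, add_self_of_Y_eq hy, sym2x_zero_zero]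
    refine ⟨x ^ 4 - W.b₄ * x ^ 2 - 2 * W.b₆ * x - W.b₈, fun h0 ↦ hF ?_, ?_⟩
    · simp [h0, hd0]
    · ext i
      fin_cases i <;> simp [hd0]
  · have hd0 : d ≠ 0 := sub_ne_zero.mpr hy
    rw [two_nsmul, add_self_of_Y_ne hy, sym2x_some_zero]
    refine ⟨d ^ 2, pow_ne_zero 2 hd0, ?_⟩
    have hX : d ^ 2 * W.toAffine.addX x x (W.toAffine.slope x x y y) =
        x ^ 4 - W.b₄ * x ^ 2 - 2 * W.b₆ * x - W.b₈ := by
      rw [slope_of_Y_ne rfl hy, ← hd, addX]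
      have : d ^ 2 * (((3 * x ^ 2 + 2 * W.a₂ * x + W.a₄ - W.a₁ * y) / d) ^ 2 +
          W.a₁ * ((3 * x ^ 2 + 2 * W.a₂ * x + W.a₄ - W.a₁ * y) / d) - W.a₂ - x - x) =
          (3 * x ^ 2 + 2 * W.a₂ * x + W.a₄ - W.a₁ * y) ^ 2 +
          W.a₁ * (3 * x ^ 2 + 2 * W.a₂ * x + W.a₄ - W.a₁ * y) * d - (W.a₂ + 2 * x) * d ^ 2 := by
        field_simp
        ring
      rw [this, hd2]
      simp only [hd, negY, b₂, b₄, b₆, b₈]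
      linear_combination (-W.a₁ ^ 2) * heq
    ext i
    fin_cases i
    · simpa [addX] using hX.symm
    · simp
    · simp

variable [AdmissibleAbsValues K]

/-- Duplication multiplies the naive height by at least `4`, up to a bounded error. -/
lemma exists_four_mul_logHeight_xRep_sub_le [W.IsElliptic] :
    ∃ C, ∀ P : W.toAffine.Point, 4 * logHeight P.xRep - C ≤ logHeight (2 • P).xRep := by
  obtain ⟨C₁, h₁⟩ := abs_logHeight_addSubMap_sub_two_mul_logHeight_le W
  obtain ⟨C₂, h₂⟩ := abs_logHeight_sym2_sub_le K
  have hsym (P Q : W.toAffine.Point) :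
      |logHeight (P.sym2x Q) - (logHeight P.xRep + logHeight Q.xRep)| ≤ C₂ := by
    have hP : P.xRep = ![P.xRep 0, P.xRep 1] := by ext i; fin_cases i <;> rfl
    have hQ : Q.xRep = ![Q.xRep 0, Q.xRep 1] := by ext i; fin_cases i <;> rfl
    have := h₂ (hP ▸ xRep_ne_zero P) (hQ ▸ xRep_ne_zero Q)
    rwa [← hP, ← hQ] at this
  refine ⟨C₁ + 3 * C₂, fun P ↦ ?_⟩
  obtain ⟨c, hc, hcP⟩ := exists_smul_sym2x_two_nsmul P
  have e₁ := h₁ (P.sym2x P)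
  rw [hcP, logHeight_smul_eq_logHeight _ hc] at e₁
  have e₂ := hsym P P
  have e₃ := hsym (2 • P) 0
  have e₄ : logHeight (0 : W.toAffine.Point).xRep = 0 := by
    rw [xRep_zero, logHeight_swap, ← logHeight₁_eq_logHeight, logHeight₁_zero]
  rw [e₄] at e₃
  rw [abs_le] at e₁ e₂ e₃
  linarith

/-- Torsion points have bounded height, by the lower bound for the height of `2P`, and hence are
finite in number. -/
theorem finite_torsion [W.IsElliptic] [Northcott (logHeight₁ (K := K))] :
    Finite (AddCommGroup.torsion W.toAffine.Point) := by
  obtain ⟨C, hC⟩ := exists_four_mul_logHeight_xRep_sub_le (W := W)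
  have := northcott_logHeight_xRep (W := W)
  exact AddCommGroup.finite_torsion_of_descent (n := 2) (b := 4) (by norm_num) hC

end WeierstrassCurve.Affine.Point

/-! ### Points over an ultrapower -/

namespace Ultrapower

open WeierstrassCurve.Affine Filter

section Points

variable {ι K : Type*} [Field K] {U : Ultrafilter ι} {E : WeierstrassCurve K}

instance _root_.WeierstrassCurve.Affine.isElliptic_baseChange [E.IsElliptic]
    (L : Type*) [Field L] [Algebra K L] :
    (E.toAffine⁄L).IsElliptic :=
  inferInstanceAs (E.map (algebraMap K L)).IsElliptic

lemma equation_coe_iff {x y : ι → K} :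
    (E.toAffine⁄(Ultrapower U K)).Equation (x : Ultrapower U K) (y : Ultrapower U K) ↔
      ∀ᶠ i in U, (E.toAffine⁄K).Equation (x i) (y i) := by
  simp only [equation_iff]
  exact Germ.coe_eq

lemma nonsingular_coe_iff [E.IsElliptic] {x y : ι → K} :
    (E.toAffine⁄(Ultrapower U K)).Nonsingular (x : Ultrapower U K) (y : Ultrapower U K) ↔
      ∀ᶠ i in U, (E.toAffine⁄K).Nonsingular (x i) (y i) := by
  rw [← equation_iff_nonsingular, equation_coe_iff]
  simp only [equation_iff_nonsingular]

lemma negY_coe (x y : ι → K) :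
    (E.toAffine⁄(Ultrapower U K)).negY (x : Ultrapower U K) (y : Ultrapower U K) =
      ((fun i ↦ (E.toAffine⁄K).negY (x i) (y i) : ι → K) : Ultrapower U K) :=
  rfl

/-- Both sides are defined by cases; since `U` is an ultrafilter, the case that holds in `*K` is the
one that holds almost everywhere. -/
lemma slope_coe [DecidableEq K] [DecidableEq (Ultrapower U K)] (x₁ x₂ y₁ y₂ : ι → K) :
    (E.toAffine⁄(Ultrapower U K)).slope (x₁ : Ultrapower U K) (x₂ : Ultrapower U K)
        (y₁ : Ultrapower U K) (y₂ : Ultrapower U K) =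
      ((fun i ↦ (E.toAffine⁄K).slope (x₁ i) (x₂ i) (y₁ i) (y₂ i) : ι → K) : Ultrapower U K) := by
  by_cases hx : ∀ᶠ i in U, x₁ i = x₂ i
  · by_cases hy : ∀ᶠ i in U, y₁ i = (E.toAffine⁄K).negY (x₂ i) (y₂ i)
    · rw [slope_of_Y_eq (Germ.coe_eq.mpr hx) (by rw [negY_coe]; exact Germ.coe_eq.mpr hy)]
      refine Germ.coe_eq.mpr ?_
      filter_upwards [hx, hy] with i hxi hyi
      exact (slope_of_Y_eq hxi hyi).symm
    · rw [slope_of_Y_ne (Germ.coe_eq.mpr hx)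
        (by rw [negY_coe]; exact fun h ↦ hy (Germ.coe_eq.mp h))]
      refine Germ.coe_eq.mpr ?_
      filter_upwards [hx, Ultrafilter.eventually_not.mpr hy] with i hxi hyi
      exact (slope_of_Y_ne hxi hyi).symm
  · rw [slope_of_X_ne fun h ↦ hx (Germ.coe_eq.mp h)]
    refine Germ.coe_eq.mpr ?_
    filter_upwards [Ultrafilter.eventually_not.mpr hx] with i hxi
    exact (slope_of_X_ne hxi).symm

/-- The affine coordinates of a point, with junk value `(0, 0)` at the point at infinity. -/
def affineCoords {W : WeierstrassCurve.Affine K} : W.Point → K × K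
  | .zero => (0, 0)
  | .some x y _ => (x, y)

lemma some_affineCoords {W : WeierstrassCurve.Affine K} {P : W.Point} (hP : P ≠ 0) :
    ∃ h, P = .some (affineCoords P).1 (affineCoords P).2 h := by
  rcases P with _ | ⟨x, y, h⟩
  · exact absurd rfl hP
  · exact ⟨h, rfl⟩

variable [E.IsElliptic]

open scoped Classical in
/-- The point of `E(*K)` given by a family of points of `E(K)`: the point at infinity if the family
is not `U`-almost everywhere affine, and the point whose coordinates are the classes of
the families of coordinates otherwise. -/
noncomputable def pointOfFamily (U : Ultrafilter ι) (f : ι → (E.toAffine⁄K).Point) :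
    (E.toAffine⁄(Ultrapower U K)).Point :=
  if h : ∀ᶠ i in U, f i ≠ 0 then
    .some ((fun i ↦ (affineCoords (f i)).1 : ι → K) : Ultrapower U K)
      ((fun i ↦ (affineCoords (f i)).2 : ι → K) : Ultrapower U K)
      (nonsingular_coe_iff.mpr <| h.mono fun _ hi ↦ (some_affineCoords hi).choose)
  else 0

lemma pointOfFamily_eq_zero_iff {f : ι → (E.toAffine⁄K).Point} :
    pointOfFamily U f = 0 ↔ ∀ᶠ i in U, f i = 0 := by
  rw [pointOfFamily]
  split_ifs with h
  · simpa [← Ultrafilter.eventually_not] using h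
  · simpa [← Ultrafilter.eventually_not] using h

lemma pointOfFamily_eq_some {f : ι → (E.toAffine⁄K).Point} {x y : ι → K}
    (hf : ∀ᶠ i in U, ∃ h, f i = .some (x i) (y i) h) :
    ∃ h, pointOfFamily U f = .some (x : Ultrapower U K) (y : Ultrapower U K) h := by
  refine ⟨nonsingular_coe_iff.mpr <| hf.mono fun _ hi ↦ hi.choose, ?_⟩
  have hf0 : ∀ᶠ i in U, f i ≠ 0 := hf.mono fun i ⟨h, hi⟩ ↦ hi ▸ Point.some_ne_zero h
  rw [pointOfFamily, dif_pos hf0, Point.some.injEq]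
  exact ⟨Germ.coe_eq.mpr <| hf.mono fun i ⟨h, hi⟩ ↦ by simp [hi, affineCoords],
    Germ.coe_eq.mpr <| hf.mono fun i ⟨h, hi⟩ ↦ by simp [hi, affineCoords]⟩

lemma pointOfFamily_congr {f g : ι → (E.toAffine⁄K).Point} (hfg : f =ᶠ[U] g) :
    pointOfFamily U f = pointOfFamily U g := by
  by_cases hf : ∀ᶠ i in U, f i = 0
  · rw [pointOfFamily_eq_zero_iff.mpr hf, eq_comm, pointOfFamily_eq_zero_iff]
    filter_upwards [hf, hfg] with i h₁ h₂
    rw [← h₂, h₁]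
  · have hf' := Ultrafilter.eventually_not.mpr hf
    obtain ⟨_, h₁⟩ := pointOfFamily_eq_some (U := U) (f := f) <|
      hf'.mono fun i hi ↦ some_affineCoords hi
    obtain ⟨_, h₂⟩ := pointOfFamily_eq_some (U := U) (f := g)
      (x := fun i ↦ (affineCoords (f i)).1) (y := fun i ↦ (affineCoords (f i)).2) <| by
      filter_upwards [hf', hfg] with i hi hi'
      rw [← hi']
      exact some_affineCoords hi
    rw [h₁, h₂]

variable [DecidableEq K] [DecidableEq (Ultrapower U K)]

lemma pointOfFamily_add (f g : ι → (E.toAffine⁄K).Point) :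
    pointOfFamily U (f + g) = pointOfFamily U f + pointOfFamily U g := by
  by_cases hf : ∀ᶠ i in U, f i = 0
  · rw [pointOfFamily_eq_zero_iff.mpr hf, zero_add]
    exact pointOfFamily_congr <| hf.mono fun i hi ↦ by simp [hi]
  by_cases hg : ∀ᶠ i in U, g i = 0
  · rw [pointOfFamily_eq_zero_iff.mpr hg, add_zero]
    exact pointOfFamily_congr <| hg.mono fun i hi ↦ by simp [hi]
  have hf' := (Ultrafilter.eventually_not.mpr hf).mono fun i hi ↦ some_affineCoords hi
  have hg' := (Ultrafilter.eventually_not.mpr hg).mono fun i hi ↦ some_affineCoords hi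
  set x₁ := fun i ↦ (affineCoords (f i)).1
  set y₁ := fun i ↦ (affineCoords (f i)).2
  set x₂ := fun i ↦ (affineCoords (g i)).1
  set y₂ := fun i ↦ (affineCoords (g i)).2
  obtain ⟨h₁, e₁⟩ := pointOfFamily_eq_some (U := U) (f := f) (x := x₁) (y := y₁) hf'
  obtain ⟨h₂, e₂⟩ := pointOfFamily_eq_some (U := U) (f := g) (x := x₂) (y := y₂) hg'
  rw [e₁, e₂]
  by_cases hxy : ∀ᶠ i in U, x₁ i = x₂ i ∧ y₁ i = (E.toAffine⁄K).negY (x₂ i) (y₂ i)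
  · rw [Point.add_of_Y_eq (Germ.coe_eq.mpr (hxy.mono fun _ h ↦ h.1))
      (by rw [negY_coe]; exact Germ.coe_eq.mpr (hxy.mono fun _ h ↦ h.2)), pointOfFamily_eq_zero_iff]
    filter_upwards [hf', hg', hxy] with i ⟨hfi, efi⟩ ⟨hgi, egi⟩ hi
    rw [Pi.add_apply, efi, egi]
    exact Point.add_of_Y_eq hi.1 hi.2
  · have hxy' : ¬((x₁ : Ultrapower U K) = x₂ ∧ (y₁ : Ultrapower U K) =
        (E.toAffine⁄(Ultrapower U K)).negY (x₂ : Ultrapower U K) (y₂ : Ultrapower U K)) := by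
      rw [negY_coe]
      exact fun h ↦ hxy ((Germ.coe_eq.mp h.1).and (Germ.coe_eq.mp h.2))
    rw [Point.add_some hxy']
    obtain ⟨h₃, e₃⟩ := pointOfFamily_eq_some (U := U) (f := f + g)
      (x := fun i ↦ (E.toAffine⁄K).addX (x₁ i) (x₂ i)
        ((E.toAffine⁄K).slope (x₁ i) (x₂ i) (y₁ i) (y₂ i)))
      (y := fun i ↦ (E.toAffine⁄K).addY (x₁ i) (x₂ i) (y₁ i)
        ((E.toAffine⁄K).slope (x₁ i) (x₂ i) (y₁ i) (y₂ i))) <| by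
      filter_upwards [hf', hg', Ultrafilter.eventually_not.mpr hxy] with i ⟨hfi, efi⟩ ⟨hgi, egi⟩ hi
      rw [Pi.add_apply]
      refine ⟨nonsingular_add hfi hgi hi, ?_⟩
      conv_lhs => rw [efi, egi]
      exact Point.add_some hi
    rw [e₃, Point.some.injEq, slope_coe]
    exact ⟨rfl, rfl⟩

/-- The homomorphism from families of points of `E(K)` to `E(*K)`. Its kernel consists of the
families vanishing `U`-almost everywhere, so it embeds the ultrapower of `E(K)` in `E(*K)`. -/
noncomputable def pointOfFamilyHom (U : Ultrafilter ι) [DecidableEq (Ultrapower U K)]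
    (E : WeierstrassCurve K) [E.IsElliptic] :
    (ι → (E.toAffine⁄K).Point) →+ (E.toAffine⁄(Ultrapower U K)).Point where
  toFun := pointOfFamily U
  map_zero' := pointOfFamily_eq_zero_iff.mpr (.of_forall fun _ ↦ rfl)
  map_add' := pointOfFamily_add

lemma pointOfFamilyHom_eq_zero_iff {f : ι → (E.toAffine⁄K).Point} :
    pointOfFamilyHom U E f = 0 ↔ ∀ᶠ i in U, f i = 0 :=
  pointOfFamily_eq_zero_iff

/-- If `E(K)` is finite, a point of `E(*K)` is given by a family of points of `E(K)` that is
constant on a set in `U`. -/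
lemma baseChange_bijective_of_finite [Finite (E.toAffine⁄K).Point] :
    Function.Bijective (Point.baseChange (W' := E.toAffine) K (Ultrapower U K)) := by
  refine ⟨Point.map_injective _, fun Q ↦ ?_⟩
  rcases Q with _ | ⟨X, Y, h⟩
  · exact ⟨0, map_zero _⟩
  induction X using Germ.inductionOn with | _ x => ?_
  induction Y using Germ.inductionOn with | _ y => ?_
  have hP : ∀ᶠ i in U, ∃ P : (E.toAffine⁄K).Point, ∃ h, P = .some (x i) (y i) h :=
    (nonsingular_coe_iff.mp h).mono fun i hi ↦ ⟨_, hi, rfl⟩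
  obtain ⟨P, hP⟩ := Ultrafilter.eventually_exists_iff.mp hP
  -- `P` is one of the members of the family, so its coordinates are `x i` and `y i`.
  obtain ⟨i, hi, rfl⟩ := hP.exists
  refine ⟨_, (Point.map_some _ hi).trans ?_⟩
  rw [Point.some.injEq]
  exact ⟨Germ.coe_eq.mpr <| hP.mono fun j ⟨_, hj⟩ ↦ (Point.some.inj hj).1,
    Germ.coe_eq.mpr <| hP.mono fun j ⟨_, hj⟩ ↦ (Point.some.inj hj).2⟩

end Points

end Ultrapower

/-! ### Ranks -/

section Rank

open Filter

/-- The kernel of `A → ℚ ⊗ A` is the torsion subgroup. -/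
lemma one_tmul_eq_zero_iff_isOfFinAddOrder {A : Type*} [AddCommGroup A] {a : A} :
    (1 : ℚ) ⊗ₜ[ℤ] a = 0 ↔ IsOfFinAddOrder a := by
  have h := IsLocalizedModule.eq_zero_iff (nonZeroDivisors ℤ) (TensorProduct.mk ℤ ℚ A 1) (m := a)
  rw [TensorProduct.mk_apply] at h
  rw [h, isOfFinAddOrder_iff_zsmul_eq_zero]
  exact ⟨fun ⟨n, hn⟩ ↦ ⟨n, nonZeroDivisors.coe_ne_zero n, hn⟩,
    fun ⟨n, hn, e⟩ ↦ ⟨⟨n, mem_nonZeroDivisors_of_ne_zero hn⟩, e⟩⟩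

lemma rank_rat_tensor_eq_zero_iff {A : Type*} [AddCommGroup A] :
    Module.rank ℚ (ℚ ⊗[ℤ] A) = 0 ↔ ∀ a : A, IsOfFinAddOrder a := by
  rw [rank_zero_iff]
  refine ⟨fun h a ↦ one_tmul_eq_zero_iff_isOfFinAddOrder.mp (Subsingleton.elim _ _), fun h ↦ ?_⟩
  refine subsingleton_of_forall_eq 0 fun t ↦ ?_
  induction t with
  | zero => rfl
  | add s t hs ht => rw [hs, ht, add_zero]
  | tmul q a =>
    rw [← mul_one q, ← smul_eq_mul, ← TensorProduct.smul_tmul',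
      one_tmul_eq_zero_iff_isOfFinAddOrder.mpr (h a), smul_zero]

lemma rank_rat_tensor_le (A : Type*) [AddCommGroup A] : Module.rank ℚ (ℚ ⊗[ℤ] A) ≤ #A := by
  have h := rank_span_le (R := ℚ) (Set.range fun a : A ↦ (1 : ℚ) ⊗ₜ[ℤ] a)
  have ht : Submodule.span ℚ (Set.range fun a : A ↦ (1 : ℚ) ⊗ₜ[ℤ] a) = ⊤ := by
    refine Submodule.eq_top_iff'.mpr fun t ↦ ?_
    induction t with
    | zero => exact zero_mem _
    | add s t hs ht => exact add_mem hs ht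
    | tmul q a =>
      rw [← mul_one q, ← smul_eq_mul, ← TensorProduct.smul_tmul']
      exact Submodule.smul_mem _ _ (Submodule.subset_span ⟨a, rfl⟩)
  rw [ht, rank_top] at h
  exact h.trans mk_range_le

/-- The functions `i ↦ ⌊e i * r⌋`, for real numbers `r`, are pairwise different almost everywhere
along a nonprincipal ultrafilter: for `r < s` they agree only where `e i * (s - r) < 1`. -/
lemma eq_of_eventually_floor_mul_eq {ι : Type*} {U : Ultrafilter ι} (hU : ∀ i, U ≠ pure i)
    (e : ι ≃ ℕ) {r s : ℝ} (h : ∀ᶠ i in U, ⌊(e i : ℝ) * r⌋ = ⌊(e i : ℝ) * s⌋) : r = s := by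
  have hle : (U : Filter ι) ≤ cofinite :=
    U.le_cofinite_or_eq_pure.resolve_right fun ⟨i, hi⟩ ↦ hU i hi
  by_contra hrs
  have hpos : 0 < |r - s| := abs_pos.mpr (sub_ne_zero.mpr hrs)
  obtain ⟨n, hn⟩ := exists_nat_gt (1 / |r - s|)
  have hfin : {i | e i < n}.Finite := (Set.finite_lt_nat n).preimage e.injective.injOn
  obtain ⟨i, hi, hin⟩ := (h.and (hle hfin.compl_mem_cofinite)).exists
  have h₁ : |(e i : ℝ) * r - e i * s| < 1 := Int.abs_sub_lt_one_of_floor_eq_floor hi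
  rw [← mul_sub, abs_mul, Nat.abs_cast] at h₁
  have h₂ : (n : ℝ) ≤ e i := by exact_mod_cast not_lt.mp hin
  rw [div_lt_iff₀ hpos] at hn
  nlinarith

/-- A homomorphism from an infinite power `A ^ ι` whose kernel is that of the passage to the
ultrapower forces `ℚ ⊗ B` to have at least `𝔠` elements as soon as `A` has an element `a` of infinite
order: the images of the families `i ↦ ⌊e i * r⌋ • a`, for real `r`, are distinct. -/
lemma continuum_le_mk_rat_tensor {ι A B : Type*} [Countable ι] [Infinite ι] {U : Ultrafilter ι}
    (hU : ∀ i, U ≠ pure i) [AddCommGroup A] [AddCommGroup B] (φ : (ι → A) →+ B)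
    (hφ : ∀ f, φ f = 0 ↔ ∀ᶠ i in U, f i = 0) {a : A} (ha : ¬IsOfFinAddOrder a) :
    𝔠 ≤ #(ℚ ⊗[ℤ] B) := by
  obtain ⟨e⟩ := nonempty_equiv_of_countable (α := ι) (β := ℕ)
  let ψ : ℝ → ℚ ⊗[ℤ] B := fun r ↦ 1 ⊗ₜ φ fun i ↦ ⌊(e i : ℝ) * r⌋ • a
  have hψ : Function.Injective ψ := fun r s hrs ↦ by
    refine eq_of_eventually_floor_mul_eq hU e ?_
    rw [← sub_eq_zero, ← TensorProduct.tmul_sub, ← map_sub, one_tmul_eq_zero_iff_isOfFinAddOrder,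
      isOfFinAddOrder_iff_zsmul_eq_zero] at hrs
    obtain ⟨n, hn, hn0⟩ := hrs
    rw [← map_zsmul, hφ] at hn0
    refine hn0.mono fun i hi ↦ ?_
    by_contra hne
    refine ha (isOfFinAddOrder_iff_zsmul_eq_zero.mpr
      ⟨n * (⌊(e i : ℝ) * r⌋ - ⌊(e i : ℝ) * s⌋), mul_ne_zero hn (sub_ne_zero.mpr hne), ?_⟩)
    simpa [mul_smul, sub_smul] using hi
  have h := Cardinal.lift_mk_le_lift_mk_of_injective hψ
  rwa [mk_real, lift_continuum, lift_uzero] at h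

lemma mk_point_le_of_infinite {F : Type*} [Field F] [Infinite F] (W : WeierstrassCurve.Affine F) :
    #W.Point ≤ #F := by
  have h : Function.Injective fun P : W.Point ↦
      (match P with | .zero => none | .some x y _ => some (x, y) : Option (F × F)) := by
    rintro (_ | ⟨x, y, h⟩) (_ | ⟨x', y', h'⟩) hP <;> simp_all
  refine (mk_le_of_injective h).trans ?_
  simp [mul_eq_self (aleph0_le_mk F), add_one_eq (aleph0_le_mk F)]

lemma Ultrapower.mk_le_continuum {ι : Type v} {K : Type u} [Countable ι] [Countable K]
    (U : Ultrafilter ι) : #(Ultrapower U K) ≤ 𝔠 := by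
  have h : Function.Surjective fun f : ι → K ↦ (f : Ultrapower U K) := Quot.mk_surjective
  refine (mk_le_of_surjective h).trans ?_
  rw [mk_pi, prod_const]
  calc lift.{v} #K ^ lift.{u} #ι ≤ ℵ₀ ^ ℵ₀ := by
        refine (power_le_power_right ?_).trans (power_le_power_left aleph0_ne_zero ?_) <;> simp
    _ = 𝔠 := aleph0_power_aleph0

end Rank

theorem theorem2p2 {ι : Type v} [Countable ι] [Infinite ι] (U : Ultrafilter ι)
    (hU : ∀ i : ι, U ≠ pure i) {K : Type u} [Field K] [NumberField K] [DecidableEq K]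
    [DecidableEq (Ultrapower U K)] (E : WeierstrassCurve K) [E.IsElliptic] :
    (ellRank E K ≠ 0 →
      ellRank E (Ultrapower U K) = 𝔠 ∧
      ℵ₀ ≤ ellRank E (Ultrapower U K) ∧
      Cardinal.lift.{v} (ellRank E K) < ellRank E (Ultrapower U K)) ∧
    (ellRank E K = 0 →
      Function.Bijective
        (WeierstrassCurve.Affine.Point.baseChange (W' := E.toAffine) K (Ultrapower U K))) := by
  refine ⟨fun h ↦ ?_, fun h ↦ ?_⟩
  · have hK : Countable K := by
      have hle := Algebra.IsAlgebraic.lift_cardinalMk_le_max ℚ K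
      exact mk_le_aleph0_iff.mp (by simpa using hle)
    have : Infinite (Ultrapower U K) := .of_injective _ (Ultrapower.diag U K).injective
    rw [ellRank, ne_eq, rank_rat_tensor_eq_zero_iff, not_forall] at h
    obtain ⟨P, hP⟩ := h
    have hlow := continuum_le_mk_rat_tensor hU (Ultrapower.pointOfFamilyHom U E)
      (fun _ ↦ Ultrapower.pointOfFamilyHom_eq_zero_iff) hP
    have hrank : ellRank E (Ultrapower U K) = 𝔠 := by
      refine le_antisymm ?_ ?_
      · exact (rank_rat_tensor_le _).trans <| (mk_point_le_of_infinite _).trans <|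
          Ultrapower.mk_le_continuum U
      · -- An uncountable `ℚ`-vector space has dimension equal to its cardinality.
        refine hlow.trans_eq (Module.Free.rank_eq_mk_of_infinite_lt ℚ _ ?_).symm
        simpa using aleph0_lt_continuum.trans_le hlow
    refine ⟨hrank, hrank ▸ aleph0_le_continuum, ?_⟩
    rw [hrank, lift_lt_continuum]
    exact ((rank_rat_tensor_le _).trans <| (mk_point_le_of_infinite _).trans
      (mk_le_aleph0_iff.mpr hK)).trans_lt aleph0_lt_continuum
  · have htors := rank_rat_tensor_eq_zero_iff.mp h
    have : Finite (E.toAffine⁄K).Point := by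
      have := WeierstrassCurve.Affine.Point.finite_torsion (W := E.toAffine⁄K)
      exact .of_injective (fun P ↦ (⟨P, htors P⟩ : AddCommGroup.torsion (E.toAffine⁄K).Point))
        fun P Q h ↦ congrArg Subtype.val h
    exact Ultrapower.baseChange_bijective_of_finite
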